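/- Fix $p$ and $\beta^*\in\mathbb R^p$. Let $\epsilon_1,\epsilon_2,\dots$ be i.i.d. real random variables with $E(\epsilon_i)=0$ and $E(\epsilon_i^2)=\sigma^2<\infty$. For each $n\ge 1$ let $X=X_n$ be a (deterministic) $n\times p$ matrix with rows $x_1^T,\dots,x_n^T$ (which may depend on $n$), let $y=X\beta^*+(\epsilon_1,\dots,\epsilon_n)^T$ and $\lambda_n\ge 0$, and let $\hat\beta^{ds}=\hat\beta^{ds}_n$ be a Dantzig selector estimator, i.e. a (measurable) solution of $$\text{minimize } \|\beta\|_1 \quad\text{subject to}\quad \tfrac1n\|X^T(y-X\beta)\|_\infty\le\lambda_n .$$ Call a symmetric $p\times p$ matrix $C$ parallel to the $\ell^1$-ball if there are $A,B\subseteq\{1,\dots,p\}$ and $w\in\mathbb R^{|B|}$ such that $\|C_Bw\|_\infty\le 1$, $C_{A,B}w\in\{\pm1\}^{|A|}$ and $\dim\operatorname{null}(C_{B,A})>0$, where $C_B$ consists of the columns of $C$ indexed by $B$ and $C_{A,B}$ of the entries of $C$ with row index in $A$ and column index in $B$. Let $\mathscr P_0^+$ be the set of invertible positive semidefinite $p\times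 p$ matrices that are not parallel to the $\ell^1$-ball. Assume that $n^{-1}X^TX\to C\in\mathscr P_0^+$, that $n^{-1}\max_{1\le i\le n}\|x_i\|^2\to 0$ (Euclidean norm), and that $\sqrt n\,\lambda_n\to\tilde\lambda_0$. Let $A^*=\{j:\beta^*_j\ne0\}$ and let $\bar A^*$ be its complement. Then for every $v\in\mathbb R^p$ the problem $$\text{minimize } \|u_{\bar A^*}\|_1+\operatorname{sign}(\beta^*)_{A^*}^Tu_{A^*}\quad\text{subject to}\quad \|Cu-v\|_\infty\le\tilde\lambda_0$$ has exactly one solution, and $$\sqrt n(\hat\beta^{ds}-\beta^*)\to u^0\quad\text{in distribution},$$ where $u^0$ is the solution of this problem for $v=v^0\sim N(0,\sigma^2C)$. The limit is in general not normal: if $p\ge1$, $\beta^*=0$, $\sigma^2>0$ and $\tilde\lambda_0>0$, then the law of $u^0$ is not Gaussian (degenerate Gaussian laws included). -/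

import Mathlib

open MeasureTheory ProbabilityTheory Filter Topology
open scoped Matrix

noncomputable section

namespace Dantzig

/-- The `ℓ¹`-norm. The norm `‖·‖` on `Fin p → ℝ` is the `ℓ^∞`-norm throughout. -/
def l1norm {p : ℕ} (b : Fin p → ℝ) : ℝ := ∑ j, |b j|

/-- `C` is parallel to the `ℓ¹`-ball: there are `A, B ⊆ {1, …, p}` and `w ∈ ℝ^B` such that
`‖C_B w‖_∞ ≤ 1` (`C_B` being the columns of `C` in `B`), `C_{A,B} w ∈ {±1}^A` and
`dim null (C_{B,A}) > 0`. -/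
def ParallelToL1Ball {p : ℕ} (C : Matrix (Fin p) (Fin p) ℝ) : Prop :=
  ∃ (A B : Finset (Fin p)) (w : B → ℝ),
    ‖C.submatrix id (Subtype.val : B → Fin p) *ᵥ w‖ ≤ 1 ∧
    (∀ i : A, (C.submatrix (Subtype.val : A → Fin p) (Subtype.val : B → Fin p) *ᵥ w) i = 1 ∨
      (C.submatrix (Subtype.val : A → Fin p) (Subtype.val : B → Fin p) *ᵥ w) i = -1) ∧
    0 < Module.finrank ℝ (LinearMap.ker
      (C.submatrix (Subtype.val : B → Fin p) (Subtype.val : A → Fin p)).mulVecLin)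

/-- Positive semidefinite matrices that are not parallel to the `ℓ¹`-ball. -/
def P0 (p : ℕ) : Set (Matrix (Fin p) (Fin p) ℝ) :=
  {C | C.PosSemidef ∧ ¬ ParallelToL1Ball C}

/-- The invertible elements of `P0 p`. -/
def P0plus (p : ℕ) : Set (Matrix (Fin p) (Fin p) ℝ) :=
  P0 p ∩ {C | IsUnit C}

/-- Feasible set of the Dantzig selector: `n⁻¹ ‖Xᵀ(y - X b)‖_∞ ≤ lam`. -/
def feasibleSet {n p : ℕ} (X : Matrix (Fin n) (Fin p) ℝ) (y : Fin n → ℝ) (lam : ℝ) :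
    Set (Fin p → ℝ) :=
  {b | (n : ℝ)⁻¹ * ‖Xᵀ *ᵥ (y - X *ᵥ b)‖ ≤ lam}

/-- `b` is a Dantzig selector estimator: a feasible point of minimal `ℓ¹`-norm. -/
def IsDantzigSelector {n p : ℕ} (X : Matrix (Fin n) (Fin p) ℝ) (y : Fin n → ℝ) (lam : ℝ)
    (b : Fin p → ℝ) : Prop :=
  b ∈ feasibleSet X y lam ∧ IsMinOn l1norm (feasibleSet X y lam) b

/-- The active set `{j | b j ≠ 0}`. -/
def activeSet {p : ℕ} (b : Fin p → ℝ) : Finset (Fin p) := Finset.univ.filter fun j => b j ≠ 0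

/-- `‖u_{Aᶜ}‖₁ + sign(b)_Aᵀ u_A`, where `A` is the active set of `b`. -/
def limitObjective {p : ℕ} (b u : Fin p → ℝ) : ℝ :=
  ∑ j ∈ (activeSet b)ᶜ, |u j| + ∑ j ∈ activeSet b, Real.sign (b j) * u j

/-- `u` minimizes `limitObjective b` subject to `‖C u - v‖_∞ ≤ lam`. -/
def IsLimitSolution {p : ℕ} (b : Fin p → ℝ) (C : Matrix (Fin p) (Fin p) ℝ) (v : Fin p → ℝ)
    (lam : ℝ) (u : Fin p → ℝ) : Prop :=
  u ∈ {w : Fin p → ℝ | ‖C *ᵥ w - v‖ ≤ lam} ∧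
    IsMinOn (limitObjective b) {w : Fin p → ℝ | ‖C *ᵥ w - v‖ ≤ lam} u

end Dantzig

end

/-! With `M = n⁻¹ XᵀX` and score `v = n^{-1/2} Xᵀε`, the rescaled error `√n (β̂ - β*)` minimizes the
rescaled `ℓ¹` increment around `β*` under `‖M u - v‖_∞ ≤ √n λ_n`. On any fixed ball this increment
equals the limiting objective once `n` is large. The argument is therefore a continuous mapping
argument for the solution map `T` of the limiting problem.

Uniqueness (`IsLimitSolution.unique`) uses duality. A subgradient `l` at one solution touches the
objective at every solution, so differences of solutions are supported on `A = {|l_j| = 1}`. In the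
coordinates `z = C u` the feasible set is a cube on which `w = C⁻¹ l` is minimized by all solutions,
so `C` times a difference vanishes on `B = supp w`. Two distinct solutions would make `C` parallel
to the `ℓ¹`-ball.

Uniqueness and compactness make `T` continuous and perturbed solutions uniformly close to `T v` for
bounded `v` (`eventually_norm_sub_lt_of_isMinOn`). The score obeys a central limit theorem
(`tendstoInDistribution_score`) and is tight, so Slutsky's lemma gives the limit `T v⁰`.

When `β* = 0`, the solution is `0` exactly when `‖v‖_∞ ≤ λ̃₀`. For nondegenerate `v⁰` this event has
probability strictly between `0` and `1`, whereas a Gaussian law with an atom is a Dirac mass. -/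

/-! ### Convex optimality and matrix preliminaries -/

/-- Optimality condition of convex programming: a minimizer of a continuous convex function over a
convex set admits a subgradient that is nonnegative in all feasible directions. -/
theorem IsMinOn.exists_subgradient {E : Type*} [AddCommGroup E] [Module ℝ E] [TopologicalSpace E]
    [IsTopologicalAddGroup E] [ContinuousSMul ℝ E] {f : E → ℝ} {S : Set E} {x : E}
    (hf : ConvexOn ℝ Set.univ f) (hfc : Continuous f) (hS : Convex ℝ S) (hx : x ∈ S)
    (hmin : IsMinOn f S x) :
    ∃ φ : StrongDual ℝ E, (∀ y, f x + φ (y - x) ≤ f y) ∧ ∀ y ∈ S, 0 ≤ φ (y - x) := by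
  have hconv : Convex ℝ {q : E × ℝ | f q.1 < q.2} := by
    simpa using hf.convex_strict_epigraph
  have hopen : IsOpen {q : E × ℝ | f q.1 < q.2} :=
    isOpen_lt (hfc.comp continuous_fst) continuous_snd
  have hdisj : Disjoint {q : E × ℝ | f q.1 < q.2} (S ×ˢ Set.Iic (f x)) := by
    rw [Set.disjoint_left]
    rintro ⟨y, t⟩ hyt ⟨hy, ht⟩
    have h1 : f x ≤ f y := hmin hy
    have h2 : f y < t := hyt
    have h3 : t ≤ f x := ht
    linarith
  -- Separate the open strict epigraph of `f` from `S × (-∞, f x]`; the slope of the hyperplane is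
  -- the subgradient.
  obtain ⟨ψ, c, hψ₁, hψ₂⟩ :=
    geometric_hahn_banach_open hconv hopen (hS.prod (convex_Iic (f x))) hdisj
  set τ := ψ (0, 1) with hτ
  have hsplit (y : E) (t : ℝ) : ψ (y, t) = ψ (y, 0) + t * τ := by
    rw [hτ, ← smul_eq_mul, ← map_smul, ← map_add]; simp
  have hc : c ≤ ψ (x, f x) := hψ₂ _ ⟨hx, le_refl (f x)⟩
  have hlt (y : E) (δ : ℝ) (hδ : 0 < δ) : ψ (y, f y) + δ * τ < c := by
    have := hψ₁ (y, f y + δ) (by simpa using hδ)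
    rw [hsplit] at this ⊢
    linarith
  -- The hyperplane is not vertical, because points above and below height `f x` over the same `x`
  -- lie on opposite sides.
  have hτneg : τ < 0 := by linarith [hlt x 1 one_pos]
  have hle (y : E) : ψ (y, f y) ≤ c := by
    by_contra! h
    have := hlt y ((ψ (y, f y) - c) / (-τ)) (div_pos (by linarith) (by linarith))
    have h2 : (ψ (y, f y) - c) / (-τ) * τ = -(ψ (y, f y) - c) := by
      field_simp [hτneg.ne]
    linarith
  have hsub (y : E) : ψ (y - x, 0) = ψ (y, 0) - ψ (x, 0) := by
    rw [← map_sub]; simp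
  refine ⟨(-τ)⁻¹ • ψ.comp (ContinuousLinearMap.inl ℝ E ℝ), fun y => ?_, fun y hy => ?_⟩
  · have h1 := hle y
    rw [hsplit] at h1 hc
    have h2 : (-τ)⁻¹ * ψ (y - x, 0) ≤ f y - f x := by
      rw [inv_mul_le_iff₀ (by linarith), hsub]
      nlinarith
    have h3 : f x + (-τ)⁻¹ * ψ (y - x, 0) ≤ f y := by linarith
    simpa using h3
  · have h1 := hψ₂ (y, f x) ⟨hy, le_refl (f x)⟩
    have h2 := hle x
    rw [hsplit] at h1 h2
    have h3 : 0 ≤ ψ (y - x, 0) := by rw [hsub]; linarith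
    simpa using mul_nonneg (inv_nonneg.2 (by linarith : (0 : ℝ) ≤ -τ)) h3

theorem Filter.Tendsto.matrix_inv {ι n : Type*} [Fintype n] [DecidableEq n] {l : Filter ι}
    {M : ι → Matrix n n ℝ} {C : Matrix n n ℝ} (hM : Tendsto M l (𝓝 C)) (hC : C.det ≠ 0) :
    Tendsto (fun i => (M i)⁻¹) l (𝓝 C⁻¹) := by
  simp only [Matrix.inv_def, Ring.inverse_eq_inv']
  have hdet : Tendsto (fun i => (M i).det) l (𝓝 C.det) :=
    ((continuous_id.matrix_det).tendsto C).comp hM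
  have hadj : Tendsto (fun i => (M i).adjugate) l (𝓝 C.adjugate) :=
    ((continuous_id.matrix_adjugate).tendsto C).comp hM
  exact (hdet.inv₀ hC).smul hadj

theorem Filter.Tendsto.matrix_mulVec {ι m n : Type*} [Fintype n] {l : Filter ι}
    {M : ι → Matrix m n ℝ} {C : Matrix m n ℝ} {w : ι → n → ℝ} {w₀ : n → ℝ}
    (hM : Tendsto M l (𝓝 C)) (hw : Tendsto w l (𝓝 w₀)) :
    Tendsto (fun i => M i *ᵥ w i) l (𝓝 (C *ᵥ w₀)) :=
  ((continuous_fst.matrix_mulVec continuous_snd).tendsto (C, w₀)).comp (hM.prodMk_nhds hw)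

theorem Matrix.submatrix_mulVec_of_support {m n k : Type*} [Fintype n] (C : Matrix m n ℝ)
    (f : k → m) (A : Finset n) {u : n → ℝ} (hu : ∀ j ∉ A, u j = 0) (i : k) :
    (C.submatrix f (Subtype.val : A → n) *ᵥ fun j : A => u j) i = (C *ᵥ u) (f i) := by
  simp only [Matrix.mulVec, dotProduct, Matrix.submatrix_apply]
  rw [Finset.sum_coe_sort A (fun j => C (f i) j * u j)]
  exact Finset.sum_subset (Finset.subset_univ A) fun j _ hj => by rw [hu j hj, mul_zero]

/-! ### The limiting problem: existence and uniqueness -/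

namespace Dantzig

variable {p : ℕ}

/-- The contribution of one coordinate to `limitObjective`. -/
noncomputable def coordObjective (s t : ℝ) : ℝ := if s = 0 then |t| else Real.sign s * t

theorem limitObjective_eq_sum (b u : Fin p → ℝ) :
    limitObjective b u = ∑ j, coordObjective (b j) (u j) := by
  classical
  rw [limitObjective, ← Finset.sum_compl_add_sum (activeSet b)]
  congr 1 <;> refine Finset.sum_congr rfl fun j hj => ?_
  · have : b j = 0 := by simpa [activeSet] using hj
    simp [coordObjective, this]
  · have : b j ≠ 0 := by simpa [activeSet] using hj
    simp [coordObjective, this]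

theorem coordObjective_smul (s t : ℝ) {a : ℝ} (ha : 0 ≤ a) :
    coordObjective s (a * t) = a * coordObjective s t := by
  unfold coordObjective
  split_ifs
  · rw [abs_mul, abs_of_nonneg ha]
  · ring

theorem coordObjective_add_le (s t t' : ℝ) :
    coordObjective s (t + t') ≤ coordObjective s t + coordObjective s t' := by
  unfold coordObjective
  split_ifs
  · exact abs_add_le t t'
  · rw [mul_add]

theorem coordObjective_le_abs (s t : ℝ) : coordObjective s t ≤ |t| := by
  unfold coordObjective
  split_ifs with h
  · exact le_rfl
  · rcases Real.sign_apply_eq_of_ne_zero s h with h | h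
    · rw [h]; simpa using neg_le_abs t
    · rw [h]; simpa using le_abs_self t

theorem coordObjective_zero (s : ℝ) : coordObjective s 0 = 0 := by simp [coordObjective]

theorem limitObjective_smul (b u : Fin p → ℝ) {a : ℝ} (ha : 0 ≤ a) :
    limitObjective b (a • u) = a * limitObjective b u := by
  simp only [limitObjective_eq_sum, Pi.smul_apply, smul_eq_mul, coordObjective_smul _ _ ha,
    Finset.mul_sum]

theorem limitObjective_add_le (b u w : Fin p → ℝ) :
    limitObjective b (u + w) ≤ limitObjective b u + limitObjective b w := by
  simp only [limitObjective_eq_sum, Pi.add_apply, ← Finset.sum_add_distrib]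
  exact Finset.sum_le_sum fun j _ => coordObjective_add_le _ _ _

theorem limitObjective_single (b : Fin p → ℝ) (j : Fin p) (t : ℝ) :
    limitObjective b (Pi.single j t) = coordObjective (b j) t := by
  rw [limitObjective_eq_sum, Finset.sum_eq_single j]
  · simp
  · intro i _ hij
    simp [Pi.single_eq_of_ne hij, coordObjective_zero]
  · simp

theorem convexOn_limitObjective (b : Fin p → ℝ) : ConvexOn ℝ Set.univ (limitObjective b) :=
  ⟨convex_univ, fun u _ w _ s t hs ht _ => by
    simpa only [limitObjective_smul b _ hs, limitObjective_smul b _ ht, smul_eq_mul] using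
      limitObjective_add_le b (s • u) (t • w)⟩

theorem continuous_limitObjective (b : Fin p → ℝ) : Continuous (limitObjective b) := by
  unfold limitObjective
  fun_prop

theorem convex_feasible (C : Matrix (Fin p) (Fin p) ℝ) (v : Fin p → ℝ) (r : ℝ) :
    Convex ℝ {w : Fin p → ℝ | ‖C *ᵥ w - v‖ ≤ r} := by
  have hset : {w : Fin p → ℝ | ‖C *ᵥ w - v‖ ≤ r} = C.mulVecLin ⁻¹' Metric.closedBall v r := by
    ext w
    simp [dist_eq_norm]
  rw [hset]
  exact (convex_closedBall v r).is_linear_preimage C.mulVecLin.isLinear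

theorem det_ne_zero_of_mem_P0plus {C : Matrix (Fin p) (Fin p) ℝ} (hC : C ∈ P0plus p) :
    C.det ≠ 0 :=
  ((Matrix.isUnit_iff_isUnit_det C).1 hC.2).ne_zero

theorem mulVec_inv_mulVec {C : Matrix (Fin p) (Fin p) ℝ} (hC : C.det ≠ 0) (v : Fin p → ℝ) :
    C *ᵥ (C⁻¹ *ᵥ v) = v := by
  rw [Matrix.mulVec_mulVec, Matrix.mul_nonsing_inv _ hC.isUnit, Matrix.one_mulVec]

theorem inv_mulVec_mulVec {C : Matrix (Fin p) (Fin p) ℝ} (hC : C.det ≠ 0) (v : Fin p → ℝ) :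
    C⁻¹ *ᵥ (C *ᵥ v) = v := by
  rw [Matrix.mulVec_mulVec, Matrix.nonsing_inv_mul _ hC.isUnit, Matrix.one_mulVec]

/-- Invertibility of `C` makes the feasible set a linear image of a closed ball, hence compact. -/
theorem exists_isLimitSolution (b : Fin p → ℝ) {C : Matrix (Fin p) (Fin p) ℝ} (hC : C.det ≠ 0)
    (v : Fin p → ℝ) {r : ℝ} (hr : 0 ≤ r) : ∃ u, IsLimitSolution b C v r u := by
  have himage : {w : Fin p → ℝ | ‖C *ᵥ w - v‖ ≤ r} =
      (fun z => C⁻¹ *ᵥ z) '' Metric.closedBall v r := by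
    ext w
    simp only [Set.mem_ofPred_eq, Set.mem_image, Metric.mem_closedBall, dist_eq_norm]
    constructor
    · exact fun h => ⟨C *ᵥ w, h, inv_mulVec_mulVec hC w⟩
    · rintro ⟨z, hz, rfl⟩
      rwa [mulVec_inv_mulVec hC]
  have hcomp : IsCompact {w : Fin p → ℝ | ‖C *ᵥ w - v‖ ≤ r} := by
    rw [himage]
    exact (isCompact_closedBall v r).image (continuous_const.matrix_mulVec continuous_id)
  have hne : {w : Fin p → ℝ | ‖C *ᵥ w - v‖ ≤ r}.Nonempty :=
    ⟨C⁻¹ *ᵥ v, by simpa [mulVec_inv_mulVec hC] using hr⟩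
  obtain ⟨u, hu, hmin⟩ := hcomp.exists_isMinOn hne (continuous_limitObjective b).continuousOn
  exact ⟨u, hu, hmin⟩

/-- If the linear form `l` lies below `limitObjective b` and touches it at `u`, then `u` vanishes in
every coordinate with `|l j| ≠ 1`. -/
theorem eq_zero_of_limitObjective_eq {b l u : Fin p → ℝ}
    (hl : ∀ w, l ⬝ᵥ w ≤ limitObjective b w) (hu : limitObjective b u = l ⬝ᵥ u) {j : Fin p}
    (hj : ¬ (l j = 1 ∨ l j = -1)) : u j = 0 := by
  have hcoord (i : Fin p) (t : ℝ) : l i * t ≤ coordObjective (b i) t := by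
    simpa [limitObjective_single] using hl (Pi.single i t)
  have heq : l j * u j = coordObjective (b j) (u j) := by
    have hsum : ∑ i, l i * u i = ∑ i, coordObjective (b i) (u i) := by
      rw [← limitObjective_eq_sum, hu]; rfl
    exact (Finset.sum_eq_sum_iff_of_le fun i _ => hcoord i (u i)).1 hsum j (Finset.mem_univ j)
  -- On the active set the objective is linear in coordinate `j`, which forces `l j` to be the sign
  -- `±1`.
  have hbj : b j = 0 := by
    by_contra hb
    apply hj
    have h1 := hcoord j 1
    have h2 := hcoord j (-1)
    simp only [coordObjective, hb, if_false] at h1 h2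
    have : l j = Real.sign (b j) := by linarith
    rw [this]
    exact (Real.sign_apply_eq_of_ne_zero _ hb).symm
  have h1 := hcoord j 1
  have h2 := hcoord j (-1)
  simp only [coordObjective, hbj, if_true, abs_neg, abs_one] at h1 h2 heq
  have h3 : l j < 1 := lt_of_le_of_ne (by linarith) fun h => hj (Or.inl h)
  have h4 : -1 < l j := lt_of_le_of_ne (by linarith) fun h => hj (Or.inr h.symm)
  rcases abs_cases (u j) with ⟨h, h'⟩ | ⟨h, h'⟩
  · rw [h] at heq
    have : (1 - l j) * u j = 0 := by linarith
    rcases mul_eq_zero.1 this with h | h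
    · linarith
    · exact h
  · rw [h] at heq
    have : (1 + l j) * u j = 0 := by linarith
    rcases mul_eq_zero.1 this with h | h
    · linarith
    · exact h

/-- Complementary slackness on both sides: the subgradient confines `u₁ - u₂` to `A`, and the dual
vector `w` annihilates `C (u₁ - u₂)` on `B`. -/
theorem IsLimitSolution.unique {b : Fin p → ℝ} {C : Matrix (Fin p) (Fin p) ℝ}
    (hC : C ∈ P0plus p) {v : Fin p → ℝ} {r : ℝ} {u₁ u₂ : Fin p → ℝ}
    (h₁ : IsLimitSolution b C v r u₁) (h₂ : IsLimitSolution b C v r u₂) : u₁ = u₂ := by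
  classical
  have hdet := det_ne_zero_of_mem_P0plus hC
  obtain ⟨φ, hφ, hφS⟩ := IsMinOn.exists_subgradient (convexOn_limitObjective b)
    (continuous_limitObjective b) (convex_feasible C v r) h₁.1 h₁.2
  set l : Fin p → ℝ := fun j => φ (Pi.single j 1) with hl
  have hφl (w : Fin p → ℝ) : φ w = l ⬝ᵥ w := by
    conv_lhs => rw [← Finset.univ_sum_single w]
    simp only [map_sum, dotProduct, hl]
    refine Finset.sum_congr rfl fun j _ => ?_
    rw [mul_comm, ← smul_eq_mul, ← map_smul, ← Pi.single_smul, smul_eq_mul, mul_one]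
  -- Positive homogeneity: testing the subgradient inequality at `0` and at `2 u₁` gives the two
  -- inequalities.
  have hu₁ : limitObjective b u₁ = l ⬝ᵥ u₁ := by
    have h0 := hφ 0
    have h2 := hφ ((2 : ℝ) • u₁)
    rw [limitObjective_smul b u₁ (by norm_num), show (2 : ℝ) • u₁ - u₁ = u₁ by
      rw [two_smul, add_sub_cancel_right], hφl] at h2
    have hzero : limitObjective b 0 = 0 := by
      simpa using limitObjective_smul b 0 (le_refl (0 : ℝ))
    rw [zero_sub, map_neg, hzero, hφl] at h0
    linarith
  have hle (w : Fin p → ℝ) : l ⬝ᵥ w ≤ limitObjective b w := by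
    have := hφ w
    rw [map_sub, hφl, hφl, hu₁] at this
    linarith
  have hf : limitObjective b u₁ = limitObjective b u₂ := le_antisymm (h₁.2 h₂.1) (h₂.2 h₁.1)
  have hφd : l ⬝ᵥ u₂ = l ⬝ᵥ u₁ := by
    have h3 := hφS u₂ h₂.1
    rw [map_sub, hφl, hφl] at h3
    have h4 := hle u₂
    linarith
  have hu₂ : limitObjective b u₂ = l ⬝ᵥ u₂ := by rw [← hf, hu₁, hφd]
  set w : Fin p → ℝ := C⁻¹ *ᵥ l with hw
  have hCw : C *ᵥ w = l := mulVec_inv_mulVec hdet l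
  have hsymm : Cᵀ = C := by simpa using hC.1.1.isHermitian.eq
  have hlw (y : Fin p → ℝ) : l ⬝ᵥ y = w ⬝ᵥ (C *ᵥ y) := by
    rw [← hCw, Matrix.dotProduct_mulVec, ← Matrix.mulVec_transpose, hsymm]
  -- replacing one coordinate of `C u₁` by that of `C u₂` keeps feasibility
  have hterm (j : Fin p) : 0 ≤ w j * ((C *ᵥ u₂) j - (C *ᵥ u₁) j) := by
    set z := C *ᵥ u₁ + Pi.single j ((C *ᵥ u₂) j - (C *ᵥ u₁) j) with hz
    have hfeas : C⁻¹ *ᵥ z ∈ {w : Fin p → ℝ | ‖C *ᵥ w - v‖ ≤ r} := by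
      rw [Set.mem_ofPred_eq, mulVec_inv_mulVec hdet,
        pi_norm_le_iff_of_nonneg ((norm_nonneg _).trans h₁.1)]
      intro i
      by_cases hij : i = j
      · subst hij
        simpa [hz] using (norm_le_pi_norm (C *ᵥ u₂ - v) i).trans h₂.1
      · simpa [hz, Pi.single_eq_of_ne hij] using (norm_le_pi_norm (C *ᵥ u₁ - v) i).trans h₁.1
    have := hφS _ hfeas
    rw [hφl, hlw, Matrix.mulVec_sub, mulVec_inv_mulVec hdet, hz, add_sub_cancel_left,
      dotProduct_single] at this
    exact this
  -- The nonnegative terms add up to `l ⬝ᵥ (u₂ - u₁) = 0`, so each of them vanishes.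
  have hsum : ∑ j, w j * ((C *ᵥ u₂) j - (C *ᵥ u₁) j) = 0 := by
    have : w ⬝ᵥ (C *ᵥ u₂ - C *ᵥ u₁) = 0 := by
      rw [dotProduct_sub, ← hlw, ← hlw, hφd, sub_self]
    simpa [dotProduct] using this
  have hzero (j : Fin p) (hj : w j ≠ 0) : (C *ᵥ (u₁ - u₂)) j = 0 := by
    have := (Finset.sum_eq_zero_iff_of_nonneg fun i _ => hterm i).1 hsum j (Finset.mem_univ j)
    rcases mul_eq_zero.1 this with h | h
    · exact absurd h hj
    · rw [Matrix.mulVec_sub, Pi.sub_apply]; linarith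
  by_contra hne
  -- With this `B`, `C_B w = C w = l`; the kernel vector of `C_{B,A}` is `u₁ - u₂` restricted to
  -- `A`.
  refine hC.1.2 ⟨Finset.univ.filter fun j => l j = 1 ∨ l j = -1,
    Finset.univ.filter fun j => w j ≠ 0, fun j => w j, ?_, ?_, ?_⟩
  · rw [pi_norm_le_iff_of_nonneg zero_le_one]
    intro i
    rw [Matrix.submatrix_mulVec_of_support C id _ (by simp), hCw, Real.norm_eq_abs, abs_le]
    have h1 := (hle (Pi.single i 1)).trans_eq (limitObjective_single b i 1)
    have h2 := (hle (Pi.single i (-1))).trans_eq (limitObjective_single b i (-1))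
    have h3 := h1.trans (coordObjective_le_abs (b i) 1)
    have h4 := h2.trans (coordObjective_le_abs (b i) (-1))
    simp only [dotProduct_single, mul_one, abs_one, abs_neg, mul_neg] at h3 h4
    exact ⟨by simpa using by linarith, h3⟩
  · rintro ⟨i, hi⟩
    rw [Matrix.submatrix_mulVec_of_support C _ _ (by simp), hCw]
    simpa using hi
  · rw [Module.finrank_pos_iff_exists_ne_zero]
    have hd (j : Fin p) (hj : j ∉ Finset.univ.filter fun j => l j = 1 ∨ l j = -1) :
        (u₁ - u₂) j = 0 := by
      have hj' : ¬ (l j = 1 ∨ l j = -1) := by simpa using hj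
      rw [Pi.sub_apply, eq_zero_of_limitObjective_eq hle hu₁ hj',
        eq_zero_of_limitObjective_eq hle hu₂ hj', sub_zero]
    refine ⟨⟨fun j => (u₁ - u₂) j, ?_⟩, ?_⟩
    · rw [LinearMap.mem_ker, Matrix.mulVecLin_apply]
      ext ⟨i, hi⟩
      rw [Matrix.submatrix_mulVec_of_support C _ _ hd]
      exact hzero i (by simpa using hi)
    · intro h
      apply hne
      rw [← sub_eq_zero]
      ext j
      by_cases hj : j ∈ Finset.univ.filter fun j => l j = 1 ∨ l j = -1
      · exact congrFun (congrArg Subtype.val h) ⟨j, hj⟩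
      · exact hd j hj

theorem existsUnique_isLimitSolution (b : Fin p → ℝ) {C : Matrix (Fin p) (Fin p) ℝ}
    (hC : C ∈ P0plus p) {r : ℝ} (hr : 0 ≤ r) (v : Fin p → ℝ) :
    ∃! u, IsLimitSolution b C v r u := by
  obtain ⟨u, hu⟩ := exists_isLimitSolution b (det_ne_zero_of_mem_P0plus hC) v hr
  exact ⟨u, hu, fun w hw => hw.unique hC hu⟩

end Dantzig

/-! ### Stability of solutions and rescaling of the Dantzig selector -/

namespace Dantzig

variable {p : ℕ}

/-- Stability of the limiting problem: solutions of perturbed problems, whose objectives agree with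
`limitObjective b` on larger and larger balls, converge to the solution of the limiting problem. -/
theorem IsLimitSolution.tendsto_of_isMinOn {ι : Type*} {l : Filter ι} {b : Fin p → ℝ}
    {C : Matrix (Fin p) (Fin p) ℝ} (hC : C ∈ P0plus p) {F : ι → (Fin p → ℝ) → ℝ}
    (hF : ∀ R : ℝ, ∀ᶠ i in l, ∀ w, ‖w‖ ≤ R → F i w = limitObjective b w)
    {M : ι → Matrix (Fin p) (Fin p) ℝ} (hM : Tendsto M l (𝓝 C))
    {v : ι → Fin p → ℝ} {v₀ : Fin p → ℝ} (hv : Tendsto v l (𝓝 v₀))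
    {r : ι → ℝ} {r₀ : ℝ} (hr : Tendsto r l (𝓝 r₀))
    {u : ι → Fin p → ℝ} {u₀ : Fin p → ℝ}
    (hu : ∀ᶠ i in l, ‖M i *ᵥ u i - v i‖ ≤ r i ∧
      IsMinOn (F i) {w | ‖M i *ᵥ w - v i‖ ≤ r i} (u i))
    (hu₀ : IsLimitSolution b C v₀ r₀ u₀) : Tendsto u l (𝓝 u₀) := by
  -- Along an ultrafilter the bounded residuals `M i *ᵥ u i - v i` converge, so it remains to
  -- identify the limit of `u` as a solution.
  rw [tendsto_iff_ultrafilter]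
  intro g hg
  have hdet := det_ne_zero_of_mem_P0plus hC
  have hM := hM.mono_left hg
  have hv := hv.mono_left hg
  have hr := hr.mono_left hg
  have hu := hu.filter_mono hg
  have hF (R : ℝ) := (hF R).filter_mono hg
  have hMinv := hM.matrix_inv hdet
  have hMdet : ∀ᶠ i in (g : Filter ι), (M i).det ≠ 0 :=
    (((continuous_id.matrix_det).tendsto C).comp hM).eventually_ne hdet
  obtain ⟨z, -, hz⟩ : ∃ z ∈ Metric.closedBall (0 : Fin p → ℝ) (r₀ + 1),
      Tendsto (fun i => M i *ᵥ u i - v i) g (𝓝 z) := by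
    have hball : ∀ᶠ i in (g : Filter ι),
        M i *ᵥ u i - v i ∈ Metric.closedBall (0 : Fin p → ℝ) (r₀ + 1) := by
      filter_upwards [hu, hr.eventually_le_const (lt_add_one r₀)] with i hi hri
      simpa using hi.1.trans hri
    obtain ⟨z, hz, hle⟩ := (isCompact_closedBall (0 : Fin p → ℝ) (r₀ + 1)).ultrafilter_le_nhds
      (g.map fun i => M i *ᵥ u i - v i) (le_principal_iff.2 hball)
    exact ⟨z, hz, hle⟩
  have hlim : Tendsto u g (𝓝 (C⁻¹ *ᵥ (z + v₀))) := by
    refine (hMinv.matrix_mulVec (hz.add hv)).congr' ?_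
    filter_upwards [hMdet] with i hi
    rw [sub_add_cancel, inv_mulVec_mulVec hi]
  have hev {x : ι → Fin p → ℝ} {x₀ : Fin p → ℝ} (hx : Tendsto x g (𝓝 x₀)) :
      ∀ᶠ i in (g : Filter ι), F i (x i) = limitObjective b (x i) := by
    filter_upwards [hF (‖x₀‖ + 1), hx.norm.eventually_le_const (lt_add_one ‖x₀‖)] with i hi hxi
    exact hi _ hxi
  have hsol : IsLimitSolution b C v₀ r₀ (C⁻¹ *ᵥ (z + v₀)) := by
    refine ⟨?_, fun w hw => ?_⟩
    · exact le_of_tendsto_of_tendsto ((hM.matrix_mulVec hlim).sub hv).norm hr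
        (hu.mono fun i hi => hi.1)
    · have hw : ‖C *ᵥ w - v₀‖ ≤ r₀ := hw
      have hr₀ : 0 ≤ r₀ := (norm_nonneg _).trans hw
      -- A recovery sequence for the competitor `w`: rescaling its residual by `r i / r₀` makes `x
      -- i` feasible for the perturbed problem. If `r₀ = 0` the residual is itself zero, so the
      -- convention `r i / 0 = 0` is harmless.
      set x : ι → Fin p → ℝ := fun i => (M i)⁻¹ *ᵥ ((r i / r₀) • (C *ᵥ w - v₀) + v i) with hx
      have hxw : Tendsto x g (𝓝 w) := by
        have hscale : Tendsto (fun i => (r i / r₀) • (C *ᵥ w - v₀)) g (𝓝 (C *ᵥ w - v₀)) := by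
          rcases hr₀.eq_or_lt with h | h
          · have h0 : C *ᵥ w - v₀ = 0 := norm_le_zero_iff.1 (h ▸ hw)
            simp [h0]
          · have := (hr.div_const r₀).smul_const (C *ᵥ w - v₀)
            rwa [div_self h.ne', one_smul] at this
        have := hMinv.matrix_mulVec (hscale.add hv)
        rwa [sub_add_cancel, inv_mulVec_mulVec hdet] at this
      have hle : ∀ᶠ i in (g : Filter ι), limitObjective b (u i) ≤ limitObjective b (x i) := by
        filter_upwards [hu, hMdet, hev hlim, hev hxw] with i hi hdi h1 h2
        rw [← h1, ← h2]
        refine hi.2 ?_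
        have hri : 0 ≤ r i := (norm_nonneg _).trans hi.1
        rw [Set.mem_ofPred_eq, hx, mulVec_inv_mulVec hdi, add_sub_cancel_right, norm_smul,
          Real.norm_eq_abs, abs_of_nonneg (div_nonneg hri hr₀)]
        calc r i / r₀ * ‖C *ᵥ w - v₀‖ ≤ r i / r₀ * r₀ :=
              mul_le_mul_of_nonneg_left hw (div_nonneg hri hr₀)
          _ ≤ r i := by
            rcases hr₀.eq_or_lt with h | h
            · simpa [← h] using hri
            · rw [div_mul_cancel₀ _ h.ne']
      exact le_of_tendsto_of_tendsto (((continuous_limitObjective b).tendsto _).comp hlim)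
        (((continuous_limitObjective b).tendsto _).comp hxw) hle
  rw [hu₀.unique hC hsol]
  exact hlim

/-- The solution of the limiting problem depends continuously on `v`. -/
theorem continuous_of_isLimitSolution {b : Fin p → ℝ} {C : Matrix (Fin p) (Fin p) ℝ}
    (hC : C ∈ P0plus p) {r : ℝ} {T : (Fin p → ℝ) → Fin p → ℝ}
    (hT : ∀ v, IsLimitSolution b C v r (T v)) : Continuous T := by
  rw [continuous_iff_continuousAt]
  exact fun v₀ => (hT v₀).tendsto_of_isMinOn hC (F := fun _ => limitObjective b) (by simp)
    (tendsto_const_nhds (x := C)) tendsto_id (tendsto_const_nhds (x := r))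
    (Eventually.of_forall fun v => hT v)

/-- On bounded sets of `v`, solutions of the perturbed problems are uniformly close to those of the
limiting problem. -/
theorem eventually_norm_sub_lt_of_isMinOn {ι : Type*} {l : Filter ι} {b : Fin p → ℝ}
    {C : Matrix (Fin p) (Fin p) ℝ} (hC : C ∈ P0plus p) {F : ι → (Fin p → ℝ) → ℝ}
    (hF : ∀ R : ℝ, ∀ᶠ i in l, ∀ w, ‖w‖ ≤ R → F i w = limitObjective b w)
    {M : ι → Matrix (Fin p) (Fin p) ℝ} (hM : Tendsto M l (𝓝 C))
    {r : ι → ℝ} {r₀ : ℝ} (hr : Tendsto r l (𝓝 r₀)) {T : (Fin p → ℝ) → Fin p → ℝ}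
    (hT : ∀ v, IsLimitSolution b C v r₀ (T v)) (R : ℝ) {δ : ℝ} (hδ : 0 < δ) :
    ∀ᶠ i in l, ∀ v u : Fin p → ℝ, ‖v‖ ≤ R → ‖M i *ᵥ u - v‖ ≤ r i →
      IsMinOn (F i) {w | ‖M i *ᵥ w - v‖ ≤ r i} u → ‖u - T v‖ < δ := by
  by_contra hcon
  rw [not_eventually] at hcon
  -- The counterexamples `(i, v, u)` carry a nontrivial filter over `l`. Along an ultrafilter finer
  -- than it, `v` converges to some `v₀`, and both `u` and `T v` tend to `T v₀`.
  set S : Set (ι × (Fin p → ℝ) × (Fin p → ℝ)) := {q | ‖q.2.1‖ ≤ R ∧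
    (‖M q.1 *ᵥ q.2.2 - q.2.1‖ ≤ r q.1 ∧
      IsMinOn (F q.1) {w | ‖M q.1 *ᵥ w - q.2.1‖ ≤ r q.1} q.2.2) ∧ δ ≤ ‖q.2.2 - T q.2.1‖} with hS
  have hne : (comap Prod.fst l ⊓ 𝓟 S).NeBot := by
    rw [← frequently_mem_iff_neBot, frequently_comap]
    refine hcon.mono fun i hi => ?_
    push Not at hi
    obtain ⟨v, u, h1, h2, h3, h4⟩ := hi
    exact ⟨(i, v, u), rfl, h1, ⟨h2, h3⟩, h4⟩
  set g := Ultrafilter.of (comap Prod.fst l ⊓ 𝓟 S)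
  have hg : (g : Filter _) ≤ comap Prod.fst l ⊓ 𝓟 S := Ultrafilter.of_le _
  have hfst : Tendsto Prod.fst (g : Filter (ι × (Fin p → ℝ) × (Fin p → ℝ))) l :=
    tendsto_comap.mono_left (hg.trans inf_le_left)
  have hgS : ∀ᶠ q in (g : Filter _), q ∈ S := le_principal_iff.1 (hg.trans inf_le_right)
  obtain ⟨v₀, -, hv₀⟩ := (isCompact_closedBall (0 : Fin p → ℝ) R).ultrafilter_le_nhds
    (g.map fun q => q.2.1) (le_principal_iff.2 (hgS.mono fun q hq => by simpa using hq.1))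
  have hv : Tendsto (fun q : ι × (Fin p → ℝ) × (Fin p → ℝ) => q.2.1) g (𝓝 v₀) := hv₀
  have hu : Tendsto (fun q : ι × (Fin p → ℝ) × (Fin p → ℝ) => q.2.2) g (𝓝 (T v₀)) :=
    (hT v₀).tendsto_of_isMinOn hC (F := fun q : ι × (Fin p → ℝ) × (Fin p → ℝ) => F q.1)
      (fun R => hfst.eventually (hF R)) (hM.comp hfst) hv (hr.comp hfst)
      (hgS.mono fun q hq => hq.2.1)
  have hTv := ((continuous_of_isLimitSolution hC hT).tendsto v₀).comp hv
  have hlim := (hu.sub hTv).norm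
  rw [sub_self, norm_zero] at hlim
  have hle := ge_of_tendsto hlim (hgS.mono fun q hq => hq.2.2)
  linarith

/-- The increment of the `ℓ¹`-norm around `b`, at scale `t⁻¹`. -/
noncomputable def localObjective (t : ℝ) (b u : Fin p → ℝ) : ℝ :=
  t * (l1norm (b + t⁻¹ • u) - l1norm b)

/-- A perturbation `t⁻¹ • u` this small flips no sign of a nonzero coordinate of `b`, so `|·|` is
linear there. -/
theorem localObjective_eq_limitObjective {t : ℝ} (ht : 0 < t) {b u : Fin p → ℝ}
    (hu : ∀ j, b j ≠ 0 → |u j| ≤ t * |b j|) : localObjective t b u = limitObjective b u := by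
  rw [limitObjective_eq_sum, localObjective, l1norm, l1norm, ← Finset.sum_sub_distrib,
    Finset.mul_sum]
  refine Finset.sum_congr rfl fun j _ => ?_
  simp only [Pi.add_apply, Pi.smul_apply, smul_eq_mul, coordObjective]
  split_ifs with hj
  · rw [hj, abs_zero, sub_zero, zero_add, abs_mul, abs_of_pos (inv_pos.2 ht),
      mul_inv_cancel_left₀ ht.ne']
  · have h1 : |t⁻¹ * u j| ≤ |b j| := by
      rw [abs_mul, abs_of_pos (inv_pos.2 ht), inv_mul_le_iff₀ ht]
      exact hu j hj
    rcases lt_or_gt_of_ne hj with hneg | hpos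
    · rw [Real.sign_of_neg hneg]
      rw [abs_of_neg hneg] at h1 ⊢
      rw [abs_of_nonpos (by linarith [(abs_le.1 h1).2])]
      field_simp
      ring
    · rw [Real.sign_of_pos hpos]
      rw [abs_of_pos hpos] at h1 ⊢
      rw [abs_of_nonneg (by linarith [(abs_le.1 h1).1])]
      field_simp
      ring

theorem eventually_localObjective_eq {ι : Type*} {l : Filter ι} {t : ι → ℝ}
    (ht : Tendsto t l atTop) (b : Fin p → ℝ) (R : ℝ) :
    ∀ᶠ i in l, ∀ w, ‖w‖ ≤ R → localObjective (t i) b w = limitObjective b w := by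
  have h : ∀ᶠ i in l, ∀ j, b j ≠ 0 → R ≤ t i * |b j| := by
    rw [eventually_all]
    intro j
    by_cases hj : b j = 0
    · simp [hj]
    · filter_upwards [(ht.atTop_mul_const (abs_pos.2 hj)).eventually_ge_atTop R] with i hi _
      exact hi
  filter_upwards [h, ht.eventually_gt_atTop 0] with i hi hti w hw
  exact localObjective_eq_limitObjective hti fun j hj =>
    ((norm_le_pi_norm w j).trans hw).trans (hi j hj)

/-- The rescaled estimation error of the Dantzig selector solves a perturbed limiting problem. -/
theorem IsDantzigSelector.isMinOn_localObjective {n : ℕ} (hn : 1 ≤ n)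
    {X : Matrix (Fin n) (Fin p) ℝ} {b : Fin p → ℝ} {e : Fin n → ℝ} {lam : ℝ} {β : Fin p → ℝ}
    (hβ : IsDantzigSelector X (X *ᵥ b + e) lam β) :
    ‖((n : ℝ)⁻¹ • (Xᵀ * X)) *ᵥ (√(n : ℝ) • (β - b)) - (√(n : ℝ))⁻¹ • (Xᵀ *ᵥ e)‖ ≤ √(n : ℝ) * lam ∧
    IsMinOn (localObjective √(n : ℝ) b)
      {w | ‖((n : ℝ)⁻¹ • (Xᵀ * X)) *ᵥ w - (√(n : ℝ))⁻¹ • (Xᵀ *ᵥ e)‖ ≤ √(n : ℝ) * lam}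
      (√(n : ℝ) • (β - b)) := by
  have hn0 : (0 : ℝ) < n := by exact_mod_cast hn
  have hs : 0 < √(n : ℝ) := Real.sqrt_pos.2 hn0
  have hss : √(n : ℝ) * √(n : ℝ) = n := Real.mul_self_sqrt hn0.le
  have hinv : (n : ℝ)⁻¹ = (√(n : ℝ))⁻¹ * (√(n : ℝ))⁻¹ := by rw [← mul_inv, hss]
  have key (w : Fin p → ℝ) :
      ‖((n : ℝ)⁻¹ • (Xᵀ * X)) *ᵥ w - (√(n : ℝ))⁻¹ • (Xᵀ *ᵥ e)‖ ≤ √(n : ℝ) * lam ↔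
        b + (√(n : ℝ))⁻¹ • w ∈ feasibleSet X (X *ᵥ b + e) lam := by
    have h1 : Xᵀ *ᵥ (X *ᵥ b + e - X *ᵥ (b + (√(n : ℝ))⁻¹ • w)) =
        -(√(n : ℝ) • (((n : ℝ)⁻¹ • (Xᵀ * X)) *ᵥ w - (√(n : ℝ))⁻¹ • (Xᵀ *ᵥ e))) := by
      rw [Matrix.mulVec_add, add_sub_add_left_eq_sub, Matrix.mulVec_sub, Matrix.mulVec_smul,
        Matrix.mulVec_smul, Matrix.mulVec_mulVec, Matrix.smul_mulVec, hinv, smul_sub, smul_smul,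
        smul_smul, mul_inv_cancel_left₀ hs.ne', mul_inv_cancel₀ hs.ne', one_smul, neg_sub]
    rw [feasibleSet, Set.mem_ofPred_eq, h1, norm_neg, norm_smul, Real.norm_eq_abs, abs_of_pos hs,
      hinv, ← mul_assoc, mul_assoc _ _ √(n : ℝ), inv_mul_cancel₀ hs.ne', mul_one,
      inv_mul_le_iff₀ hs]
  have hback : b + (√(n : ℝ))⁻¹ • (√(n : ℝ) • (β - b)) = β := by
    rw [smul_smul, inv_mul_cancel₀ hs.ne', one_smul, add_sub_cancel]
  refine ⟨(key _).2 (hback.symm ▸ hβ.1), fun w hw => ?_⟩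
  have hle : l1norm β ≤ l1norm (b + (√(n : ℝ))⁻¹ • w) := hβ.2 ((key w).1 hw)
  rw [Set.mem_ofPred_eq, localObjective, localObjective, hback]
  exact mul_le_mul_of_nonneg_left (by linarith) hs.le

end Dantzig

/-! ### Central limit theorem for the score -/

theorem norm_prod_sub_prod_le {ι : Type*} (s : Finset ι) (z w : ι → ℂ)
    (hz : ∀ i ∈ s, ‖z i‖ ≤ 1) (hw : ∀ i ∈ s, ‖w i‖ ≤ 1) :
    ‖∏ i ∈ s, z i - ∏ i ∈ s, w i‖ ≤ ∑ i ∈ s, ‖z i - w i‖ := by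
  classical
  induction s using Finset.induction_on with
  | empty => simp
  | insert a s ha ih =>
    rw [Finset.prod_insert ha, Finset.prod_insert ha, Finset.sum_insert ha]
    have h1 := ih (fun i hi => hz i (Finset.mem_insert_of_mem hi))
      (fun i hi => hw i (Finset.mem_insert_of_mem hi))
    have h2 : ‖∏ i ∈ s, w i‖ ≤ 1 := by
      rw [norm_prod]
      exact Finset.prod_le_one (fun _ _ => norm_nonneg _)
        fun i hi => hw i (Finset.mem_insert_of_mem hi)
    have h3 := hz a (Finset.mem_insert_self a s)
    calc ‖z a * ∏ i ∈ s, z i - w a * ∏ i ∈ s, w i‖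
        = ‖(z a - w a) * ∏ i ∈ s, w i + z a * (∏ i ∈ s, z i - ∏ i ∈ s, w i)‖ := by ring_nf
      _ ≤ ‖z a - w a‖ * ‖∏ i ∈ s, w i‖ + ‖z a‖ * ‖∏ i ∈ s, z i - ∏ i ∈ s, w i‖ := by
        rw [← norm_mul, ← norm_mul]; exact norm_add_le _ _
      _ ≤ ‖z a - w a‖ * 1 + 1 * ∑ i ∈ s, ‖z i - w i‖ := by gcongr
      _ = _ := by ring

/-- A product of values `f (a i)`, where `f` is bounded by `1` and `f t = 1 - s t² / 2 + o(t²)`, is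
asymptotically `exp (- s ∑ (a i)² / 2)` when the `a i` are uniformly small. -/
theorem tendsto_prod_of_isLittleO {f : ℝ → ℂ} {s : ℝ} (hs : 0 ≤ s) (hf1 : ∀ t, ‖f t‖ ≤ 1)
    (hf : (fun t : ℝ => f t - (1 - s * t ^ 2 / 2 : ℝ)) =o[𝓝 0] fun t : ℝ => t ^ 2)
    (a : (n : ℕ) → Fin n → ℝ) {q : ℝ}
    (hsum : Tendsto (fun n => ∑ i, a n i ^ 2) atTop (𝓝 q))
    (hmax : ∀ δ > 0, ∀ᶠ n in atTop, ∀ i, |a n i| < δ) :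
    Tendsto (fun n => ∏ i, f (a n i)) atTop (𝓝 (Real.exp (-(s * q / 2)) : ℝ)) := by
  have hexp : (fun t : ℝ => ((Real.exp (-(s * t ^ 2 / 2)) : ℝ) : ℂ) - (1 - s * t ^ 2 / 2 : ℝ))
      =o[𝓝 0] fun t : ℝ => t ^ 2 := by
    have h0 : (fun x : ℝ => Real.exp x - (1 + x)) =o[𝓝 0] fun x : ℝ => x := by
      have := (Real.hasDerivAt_exp 0).isLittleO
      simpa [sub_sub] using this
    have ht : Tendsto (fun t : ℝ => -(s * t ^ 2 / 2)) (𝓝 0) (𝓝 0) := by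
      have : Continuous fun t : ℝ => -(s * t ^ 2 / 2) := by fun_prop
      simpa using this.tendsto 0
    have hO : ((fun x : ℝ => x) ∘ fun t : ℝ => -(s * t ^ 2 / 2)) =O[𝓝 0] fun t : ℝ => t ^ 2 := by
      refine ((Asymptotics.isBigO_refl (fun t : ℝ => t ^ 2) (𝓝 0)).const_mul_left
        (-(s / 2))).congr_left fun t => ?_
      simp only [Function.comp]
      ring
    have h1 := (h0.comp_tendsto ht).trans_isBigO hO
    rw [← Asymptotics.isLittleO_norm_left] at h1 ⊢
    refine h1.congr_left fun t => ?_
    rw [← Complex.ofReal_sub, Complex.norm_real]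
    simp [sub_eq_add_neg]
  have hdiff := hf.sub hexp
  have hexpsum : Tendsto (fun n => ∏ i, ((Real.exp (-(s * a n i ^ 2 / 2)) : ℝ) : ℂ)) atTop
      (𝓝 (Real.exp (-(s * q / 2)) : ℝ)) := by
    have : Tendsto (fun n => ((Real.exp (-(s * (∑ i, a n i ^ 2) / 2)) : ℝ) : ℂ)) atTop
        (𝓝 (Real.exp (-(s * q / 2)) : ℝ)) := by
      have hc : Continuous fun x : ℝ => ((Real.exp (-(s * x / 2)) : ℝ) : ℂ) := by fun_prop
      exact (hc.tendsto q).comp hsum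
    refine this.congr fun n => ?_
    rw [← Complex.ofReal_prod, ← Real.exp_sum, Finset.sum_neg_distrib, ← Finset.sum_div,
      ← Finset.mul_sum]
  have hzero : Tendsto (fun n => ∏ i, f (a n i) -
      ∏ i, ((Real.exp (-(s * a n i ^ 2 / 2)) : ℝ) : ℂ)) atTop (𝓝 0) := by
    rw [Metric.tendsto_nhds]
    intro η hη
    have hq : 0 < |q| + 1 := by positivity
    -- Since `∑ (a n i)²` is eventually at most `|q| + 1`, this constant bounds the total error by
    -- `η / 2`.
    have hc : 0 < η / (2 * (|q| + 1)) := by positivity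
    obtain ⟨δ, hδ, hδ'⟩ := Metric.eventually_nhds_iff.1 (hdiff.def hc)
    filter_upwards [hmax δ hδ, hsum.eventually_le_const
      (lt_of_le_of_lt (le_abs_self q) (lt_add_one |q|))] with n hn hn'
    rw [dist_zero_right]
    calc _ ≤ ∑ i, ‖f (a n i) - ((Real.exp (-(s * a n i ^ 2 / 2)) : ℝ) : ℂ)‖ := by
          refine norm_prod_sub_prod_le _ _ _ (fun i _ => hf1 _) fun i _ => ?_
          rw [Complex.norm_real, Real.norm_eq_abs, Real.abs_exp, Real.exp_le_one_iff]
          have : 0 ≤ s * a n i ^ 2 / 2 := by positivity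
          linarith
      _ ≤ ∑ i, η / (2 * (|q| + 1)) * a n i ^ 2 := by
          refine Finset.sum_le_sum fun i _ => ?_
          have := hδ' (y := a n i) (by simpa using hn i)
          simpa using this
      _ = η / (2 * (|q| + 1)) * ∑ i, a n i ^ 2 := by rw [Finset.mul_sum]
      _ ≤ η / (2 * (|q| + 1)) * (|q| + 1) := by gcongr
      _ < η := by
          have : η / (2 * (|q| + 1)) * (|q| + 1) = η / 2 := by field_simp
          rw [this]; linarith
  simpa using hzero.add hexpsum

/-- Second order expansion at `0` of the characteristic function of a centered square integrable
random variable. -/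
theorem charFun_sub_isLittleO_of_mean_zero {Ω : Type*} [MeasurableSpace Ω] {P : Measure Ω}
    [IsProbabilityMeasure P] {Y : Ω → ℝ} (hY : AEMeasurable Y P)
    (hsq : Integrable (fun ω => Y ω ^ 2) P) (h0 : ∫ ω, Y ω ∂P = 0) :
    (fun t : ℝ => charFun (P.map Y) t - (1 - (∫ ω, Y ω ^ 2 ∂P) * t ^ 2 / 2 : ℝ))
      =o[𝓝 0] fun t : ℝ => t ^ 2 := by
  have : IsProbabilityMeasure (P.map Y) := Measure.isProbabilityMeasure_map hY
  have hmem : MemLp id 2 (P.map Y) := by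
    rw [memLp_map_measure_iff (by fun_prop) hY]
    exact (memLp_two_iff_integrable_sq hY.aestronglyMeasurable).2 hsq
  have htaylor := taylor_isLittleO_univ (n := 2) (x₀ := (0 : ℝ)) (f := charFun (P.map Y))
    (contDiff_charFun hmem)
  simp only [taylorWithinEval_charFun_two_zero hY hmem, h0, sub_zero] at htaylor
  refine htaylor.congr_left fun t => ?_
  simp

theorem dotProduct_mulVec_transpose {m n : Type*} [Fintype m] [Fintype n] (X : Matrix m n ℝ)
    (e : m → ℝ) (t : n → ℝ) : t ⬝ᵥ (Xᵀ *ᵥ e) = ∑ i, (X *ᵥ t) i * e i := by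
  rw [Matrix.dotProduct_mulVec, Matrix.vecMul_transpose]; rfl

theorem mulVec_apply_sq_le {m n : Type*} [Fintype n] (X : Matrix m n ℝ) (t : n → ℝ)
    (i : m) : (X *ᵥ t) i ^ 2 ≤ (∑ j, X i j ^ 2) * ∑ j, t j ^ 2 :=
  Finset.sum_mul_sq_le_sq_mul_sq _ _ _

theorem measurable_score {Ω : Type*} [MeasurableSpace Ω] {n p : ℕ} {ε : ℕ → Ω → ℝ}
    (hε_meas : ∀ i, Measurable (ε i)) (X : Matrix (Fin n) (Fin p) ℝ) :
    Measurable fun ω => WithLp.toLp 2 ((√(n : ℝ))⁻¹ • (Xᵀ *ᵥ fun i : Fin n => ε i ω)) := by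
  refine (WithLp.measurable_toLp 2 _).comp ?_
  have : Measurable fun ω => (fun i : Fin n => ε i ω) := measurable_pi_iff.2 fun i => hε_meas i
  have hc : Continuous fun e : Fin n → ℝ => (√(n : ℝ))⁻¹ • (Xᵀ *ᵥ e) := by fun_prop
  exact hc.measurable.comp this

theorem charFun_score {Ω : Type*} [MeasurableSpace Ω] {P : Measure Ω} [IsProbabilityMeasure P]
    {n p : ℕ} {ε : ℕ → Ω → ℝ} (hε_meas : ∀ i, Measurable (ε i)) (hε_indep : iIndepFun ε P)
    (hε_ident : ∀ i, IdentDistrib (ε i) (ε 0) P P) (X : Matrix (Fin n) (Fin p) ℝ)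
    (t : EuclideanSpace ℝ (Fin p)) :
    charFun (P.map fun ω => WithLp.toLp 2
      ((√(n : ℝ))⁻¹ • (Xᵀ *ᵥ fun i : Fin n => ε i ω))) t =
      ∏ i, charFun (P.map (ε 0)) ((√(n : ℝ))⁻¹ * (X *ᵥ t.ofLp) i) := by
  have hind : iIndepFun (fun i : Fin n => ε i) P := hε_indep.precomp Fin.val_injective
  have hmeas : Measurable fun ω => WithLp.toLp 2 (fun i : Fin n => ε i ω) :=
    (WithLp.measurable_toLp 2 _).comp (measurable_pi_iff.2 fun i => hε_meas i)
  -- By transposition `⟨t, n^{-1/2} Xᵀε⟩ = ⟨n^{-1/2} X t, ε⟩`, so the joint characteristic function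
  -- of the errors is evaluated at `n^{-1/2} X t`.
  have hprod := (iIndepFun_iff_charFun_pi fun i : Fin n => (hε_meas i).aemeasurable).1 hind
    (WithLp.toLp 2 fun i => (√(n : ℝ))⁻¹ * (X *ᵥ t.ofLp) i)
  simp only [fun i : Fin n => (hε_ident i).map_eq] at hprod
  rw [← hprod, charFun_apply, charFun_apply,
    integral_map (measurable_score hε_meas X).aemeasurable (by fun_prop),
    integral_map hmeas.aemeasurable (by fun_prop)]
  congr 1 with ω
  congr 3
  simp only [PiLp.inner_apply, RCLike.inner_apply, conj_trivial]
  have h := dotProduct_mulVec_transpose X (fun i : Fin n => ε i ω) t.ofLp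
  calc _ = (√(n : ℝ))⁻¹ * (t.ofLp ⬝ᵥ (Xᵀ *ᵥ fun i : Fin n => ε i ω)) := by
        rw [← smul_eq_mul, ← dotProduct_smul]; rfl
    _ = _ := by
        rw [h, Finset.mul_sum]
        exact Finset.sum_congr rfl fun i _ => (mul_assoc _ _ _).symm

/-- **Central limit theorem** for the score `n^{-1/2} Xᵀ ε` of a linear model with deterministic
design satisfying Lindeberg's condition. -/
theorem tendstoInDistribution_score {Ω Ω' : Type*} [MeasurableSpace Ω] {P : Measure Ω}
    [IsProbabilityMeasure P] [MeasurableSpace Ω'] {P' : Measure Ω'} [IsProbabilityMeasure P']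
    {p : ℕ} {ε : ℕ → Ω → ℝ} (hε_meas : ∀ i, Measurable (ε i)) (hε_indep : iIndepFun ε P)
    (hε_ident : ∀ i, IdentDistrib (ε i) (ε 0) P P) {s : ℝ}
    (hε_sq : Integrable (fun ω => ε 0 ω ^ 2) P)
    (hε_mean : ∫ ω, ε 0 ω ∂P = 0) (hε_var : ∫ ω, ε 0 ω ^ 2 ∂P = s)
    {X : (n : ℕ) → Matrix (Fin n) (Fin p) ℝ}
    {C : Matrix (Fin p) (Fin p) ℝ} (hC : C.PosSemidef)
    (hX : Tendsto (fun n : ℕ => (n : ℝ)⁻¹ • ((X n)ᵀ * X n)) atTop (𝓝 C))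
    (hXmax : Tendsto (fun n : ℕ => (n : ℝ)⁻¹ * ⨆ i : Fin n, ∑ j, X n i j ^ 2) atTop (𝓝 0))
    {Z : Ω' → EuclideanSpace ℝ (Fin p)} (hZ : HasLaw Z (multivariateGaussian 0 (s • C)) P') :
    TendstoInDistribution (fun (n : ℕ) ω => WithLp.toLp 2
      ((√(n : ℝ))⁻¹ • ((X n)ᵀ *ᵥ fun i : Fin n => ε i ω))) atTop Z (fun _ => P) P' where
  forall_aemeasurable n := (measurable_score hε_meas (X n)).aemeasurable
  aemeasurable_limit := hZ.aemeasurable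
  tendsto := by
    have hs : 0 ≤ s := hε_var ▸ integral_nonneg fun ω => sq_nonneg _
    refine ProbabilityMeasure.tendsto_iff_tendsto_charFun.2 fun t => ?_
    rw! [hZ.map_eq]
    simp only [ProbabilityMeasure.coe_mk]
    have hlimit : charFun (multivariateGaussian 0 (s • C)) t =
        (Real.exp (-(s * (t.ofLp ⬝ᵥ C *ᵥ t.ofLp) / 2)) : ℝ) := by
      rw [charFun_multivariateGaussian (hC.smul hs)]
      simp [Matrix.smul_mulVec, dotProduct_smul]
    rw [hlimit]
    set a : (n : ℕ) → Fin n → ℝ := fun n i => (√(n : ℝ))⁻¹ * (X n *ᵥ t.ofLp) i with ha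
    have hsq (n : ℕ) (i : Fin n) : a n i ^ 2 = (n : ℝ)⁻¹ * (X n *ᵥ t.ofLp) i ^ 2 := by
      rw [ha, mul_pow, inv_pow, Real.sq_sqrt (Nat.cast_nonneg n)]
    have hchar (n : ℕ) : charFun (P.map fun ω => WithLp.toLp 2
        ((√(n : ℝ))⁻¹ • ((X n)ᵀ *ᵥ fun i : Fin n => ε i ω))) t =
        ∏ i, charFun (P.map (ε 0)) (a n i) :=
      charFun_score hε_meas hε_indep hε_ident (X n) t
    simp_rw [hchar]
    refine tendsto_prod_of_isLittleO hs (fun t => ?_) ?_ a ?_ ?_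
    · have : IsProbabilityMeasure (P.map (ε 0)) :=
        Measure.isProbabilityMeasure_map (hε_meas 0).aemeasurable
      exact norm_charFun_le_one t
    · simpa only [hε_var] using
        charFun_sub_isLittleO_of_mean_zero (hε_meas 0).aemeasurable hε_sq hε_mean
    · have hc : Continuous fun M : Matrix (Fin p) (Fin p) ℝ => t.ofLp ⬝ᵥ M *ᵥ t.ofLp := by
        fun_prop
      refine ((hc.tendsto C).comp hX).congr fun n => ?_
      simp only [Function.comp, Matrix.smul_mulVec, dotProduct_smul, hsq, ← Finset.mul_sum,
        smul_eq_mul]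
      rw [← Matrix.mulVec_mulVec, dotProduct_mulVec_transpose]
      simp only [sq]
    -- Cauchy–Schwarz bounds `(a n i)²` by `n⁻¹ ‖x_i‖² ‖t‖²`, uniformly small by `hXmax`.
    · intro δ hδ
      set K := ∑ j, t.ofLp j ^ 2 with hK
      have hK0 : 0 ≤ K := Finset.sum_nonneg fun j _ => sq_nonneg _
      have hev := (hXmax.mul_const K).eventually_lt_const (u := δ ^ 2) (by simpa using by positivity)
      filter_upwards [hev] with n hn i
      refine abs_lt_of_sq_lt_sq (lt_of_le_of_lt ?_ hn) hδ.le
      rw [hsq, mul_assoc]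
      refine mul_le_mul_of_nonneg_left ((mulVec_apply_sq_le _ _ _).trans ?_) (by positivity)
      refine mul_le_mul_of_nonneg_right ?_ hK0
      exact le_ciSup (f := fun i : Fin n => ∑ j, X n i j ^ 2) (Set.finite_range _).bddAbove i

/-! ### Full support of Gaussian laws and non-normality of the limit -/

instance isOpenPosMeasure_stdGaussian {ι : Type*} [Fintype ι] :
    (stdGaussian (EuclideanSpace ℝ ι)).IsOpenPosMeasure := by
  have : (gaussianReal 0 1).IsOpenPosMeasure :=
    (gaussianReal_absolutelyContinuous' 0 one_ne_zero).isOpenPosMeasure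
  rw [← map_pi_eq_stdGaussian]
  exact (PiLp.continuous_toLp 2 _).isOpenPosMeasure_map (WithLp.toLp_surjective 2)

open scoped MatrixOrder in
theorem isOpenPosMeasure_multivariateGaussian {ι : Type*} [Fintype ι] [DecidableEq ι]
    (μ : EuclideanSpace ℝ ι) {S : Matrix ι ι ℝ} (hS : S.PosSemidef) (hdet : S.det ≠ 0) :
    (multivariateGaussian μ S).IsOpenPosMeasure := by
  unfold multivariateGaussian
  refine Continuous.isOpenPosMeasure_map (by fun_prop) fun y => ?_
  -- `√S S⁻¹` is a right inverse of `√S`, since `√S √S = S`.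
  refine ⟨Matrix.toEuclideanCLM (𝕜 := ℝ) (CFC.sqrt S * S⁻¹) (y - μ), ?_⟩
  rw [← ContinuousLinearMap.comp_apply, ← ContinuousLinearMap.mul_def, ← map_mul, ← mul_assoc,
    CFC.sqrt_mul_sqrt_self _ hS.nonneg, Matrix.mul_nonsing_inv _ hdet.isUnit, map_one,
    one_apply_eq_self, add_sub_cancel]

/-- A Gaussian law with an atom is a Dirac mass. -/
theorem IsGaussian.measure_singleton_eq_one {ι : Type*} [Fintype ι] {μ : Measure (ι → ℝ)}
    [IsGaussian μ] {x : ι → ℝ} (hx : μ {x} ≠ 0) : μ {x} = 1 := by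
  -- Each marginal is a real Gaussian with an atom at `x j`, so its variance is zero.
  have hcoord (j : ι) : ∀ᵐ y ∂μ, y j = x j := by
    have hmap := IsGaussian.map_eq_gaussianReal (μ := μ)
      (ContinuousLinearMap.proj (R := ℝ) (φ := fun _ : ι => ℝ) j)
    set L := ContinuousLinearMap.proj (R := ℝ) (φ := fun _ : ι => ℝ) j
    have hL : AEMeasurable L μ := L.continuous.aemeasurable
    have hpos : μ.map L {x j} ≠ 0 := by
      rw [Measure.map_apply_of_aemeasurable hL (measurableSet_singleton _)]
      refine fun h => hx (measure_mono_null ?_ h)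
      rintro y rfl
      rfl
    by_cases hv : (Var[L; μ]).toNNReal = 0
    · rw [hv, gaussianReal_zero_var] at hmap
      have hm : μ[L] = x j := by
        by_contra hne
        apply hpos
        rw [hmap, Measure.dirac_apply' _ (measurableSet_singleton _), Set.indicator_of_notMem]
        exact hne
      have hae : ∀ᵐ z ∂(μ.map L), z = x j := by
        rw [hmap, hm, ae_dirac_eq]
        exact eventually_pure.2 rfl
      exact ae_of_ae_map hL hae
    · have := nullSingletonClass_gaussianReal (μ := μ[L]) hv
      rw [hmap] at hpos
      exact absurd (measure_singleton _) hpos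
  have hae : ∀ᵐ y ∂μ, y ∈ ({x} : Set (ι → ℝ)) := by
    filter_upwards [ae_all_iff.2 hcoord] with y hy
    exact funext hy
  exact (mem_ae_iff_prob_eq_one (measurableSet_singleton x)).1 hae

namespace Dantzig

variable {p : ℕ}

theorem isLimitSolution_zero {C : Matrix (Fin p) (Fin p) ℝ} {v : Fin p → ℝ} {r : ℝ}
    (hv : ‖v‖ ≤ r) : IsLimitSolution 0 C v r 0 := by
  refine ⟨by simpa using hv, fun w _ => ?_⟩
  simp only [Set.mem_ofPred_eq, limitObjective_eq_sum, coordObjective, Pi.zero_apply, if_true,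
    abs_zero, Finset.sum_const_zero]
  exact Finset.sum_nonneg fun j _ => abs_nonneg _

/-- For `b = 0` the solution of the limiting problem vanishes with a probability strictly between
`0` and `1`, so that it is not Gaussian. -/
theorem not_isGaussian_map_of_isLimitSolution_zero {Ω : Type*} [MeasurableSpace Ω] {P : Measure Ω}
    [IsProbabilityMeasure P] (hp : 1 ≤ p) {C : Matrix (Fin p) (Fin p) ℝ} (hC : C ∈ P0plus p)
    {s r : ℝ} (hs : 0 < s) (hr : 0 < r) {V : Ω → EuclideanSpace ℝ (Fin p)} {U : Ω → Fin p → ℝ}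
    (hV : HasLaw V (multivariateGaussian 0 (s • C)) P) (hU : AEMeasurable U P)
    (hsol : ∀ᵐ ω ∂P, IsLimitSolution 0 C (V ω).ofLp r (U ω)) : ¬ IsGaussian (P.map U) := by
  intro hG
  have hopen : (multivariateGaussian (0 : EuclideanSpace ℝ (Fin p)) (s • C)).IsOpenPosMeasure := by
    refine isOpenPosMeasure_multivariateGaussian 0 (hC.1.1.smul hs.le) ?_
    rw [Matrix.det_smul]
    exact mul_ne_zero (pow_ne_zero _ hs.ne') (det_ne_zero_of_mem_P0plus hC)
  have hnorm : Continuous fun x : EuclideanSpace ℝ (Fin p) => ‖x.ofLp‖ :=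
    (PiLp.continuous_ofLp 2 _).norm
  have hpos {A : Set (EuclideanSpace ℝ (Fin p))} (hA : IsOpen A) (hne : A.Nonempty) :
      P (V ⁻¹' A) ≠ 0 := by
    rw [← Measure.map_apply_of_aemeasurable hV.aemeasurable hA.measurableSet, hV.map_eq]
    exact (hA.measure_pos _ hne).ne'
  have hatom : P.map U {0} ≠ 0 := by
    rw [Measure.map_apply_of_aemeasurable hU (measurableSet_singleton _)]
    intro h
    refine hpos (isOpen_lt hnorm (continuous_const (y := r))) ⟨0, by simpa using hr⟩ ?_
    have hnot : ∀ᵐ ω ∂P, ω ∉ U ⁻¹' {0} := measure_eq_zero_iff_ae_notMem.1 h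
    refine measure_eq_zero_iff_ae_notMem.2 ?_
    filter_upwards [hsol, hnot] with ω hω hω' hlt
    exact hω' (hω.unique hC (isLimitSolution_zero (le_of_lt hlt)))
  have hone := IsGaussian.measure_singleton_eq_one hatom
  have := Measure.isProbabilityMeasure_map hU
  have hae : ∀ᵐ ω ∂P, U ω = 0 :=
    ae_of_ae_map hU ((mem_ae_iff_prob_eq_one (measurableSet_singleton _)).2 hone)
  -- If `U = 0` almost surely, feasibility of `0` gives `‖V‖_∞ ≤ r` almost surely, yet the open set
  -- `‖v‖_∞ > r` is charged.
  refine hpos (isOpen_lt (continuous_const (y := r)) hnorm)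
    ⟨WithLp.toLp 2 fun _ => r + 1, ?_⟩ ?_
  · have h := norm_le_pi_norm (fun _ : Fin p => r + 1) ⟨0, hp⟩
    have h' : r + 1 ≤ ‖fun _ : Fin p => r + 1‖ := (le_abs_self _).trans h
    exact lt_of_lt_of_le (lt_add_one r) h'
  · refine measure_eq_zero_iff_ae_notMem.2 ?_
    filter_upwards [hsol, hae] with ω hω h0 hlt
    have h1 := hω.1
    rw [h0, Set.mem_ofPred_eq, Matrix.mulVec_zero, zero_sub, norm_neg] at h1
    exact absurd hlt (not_lt.2 h1)

end Dantzig

/-! ### Tightness and the main theorem -/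

/-- A sequence that converges in distribution is asymptotically tight. -/
theorem MeasureTheory.TendstoInDistribution.exists_eventually_measure_norm_ge_lt
    {ι E Ω Ω' : Type*} [NormedAddCommGroup E] [CompleteSpace E] [SecondCountableTopology E]
    [MeasurableSpace E] [BorelSpace E] [MeasurableSpace Ω] [MeasurableSpace Ω'] {P : Measure Ω}
    [IsProbabilityMeasure P] {P' : Measure Ω'} [IsProbabilityMeasure P'] {l : Filter ι}
    {V : ι → Ω → E} {Z : Ω' → E} (h : TendstoInDistribution V l Z (fun _ => P) P')
    {δ : ENNReal} (hδ : 0 < δ) : ∃ R : ℝ, ∀ᶠ i in l, P {ω | R ≤ ‖V i ω‖} < δ := by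
  have := Measure.isProbabilityMeasure_map h.aemeasurable_limit
  have htight := tendsto_measure_norm_gt_of_isTightMeasureSet
    (isTightMeasureSet_singleton (μ := P'.map Z))
  simp only [Set.mem_singleton_iff, iSup_iSup_eq_left] at htight
  obtain ⟨R, hR⟩ := (htight.eventually_lt_const hδ).exists
  -- The portmanteau bound needs a closed set; the radius `R + 1` places it inside `{‖x‖ > R}`.
  have hclosed : IsClosed {x : E | R + 1 ≤ ‖x‖} := isClosed_le continuous_const continuous_norm
  have hlim := ProbabilityMeasure.limsup_measure_closed_le_of_tendsto h.tendsto hclosed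
  have hlt : (P'.map Z) {x : E | R + 1 ≤ ‖x‖} < δ :=
    lt_of_le_of_lt (measure_mono fun x hx => lt_of_lt_of_le (lt_add_one R) hx) hR
  refine ⟨R + 1, (eventually_lt_of_limsup_lt (lt_of_le_of_lt hlim hlt)).mono fun i hi => ?_⟩
  rwa [ProbabilityMeasure.coe_mk,
    Measure.map_apply_of_aemeasurable (h.forall_aemeasurable i) hclosed.measurableSet] at hi

theorem corollary2 {Ω : Type*} [MeasurableSpace Ω] (P : Measure Ω) [IsProbabilityMeasure P]
    (p : ℕ) (βstar : Fin p → ℝ)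
    -- iid errors with mean `0` and variance `σ²`
    (ε : ℕ → Ω → ℝ) (hε_meas : ∀ i, Measurable (ε i)) (hε_indep : iIndepFun ε P)
    (hε_ident : ∀ i, IdentDistrib (ε i) (ε 0) P P)
    (σ : ℝ) (hε_sq : ∀ i, Integrable (fun ω => ε i ω ^ 2) P)
    (hε_mean : ∀ i, ∫ ω, ε i ω ∂P = 0) (hε_var : ∀ i, ∫ ω, ε i ω ^ 2 ∂P = σ ^ 2)
    -- `X n` is the `n × p` design matrix of the sample of size `n`
    (X : (n : ℕ) → Matrix (Fin n) (Fin p) ℝ)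
    (C : Matrix (Fin p) (Fin p) ℝ) (hC : C ∈ Dantzig.P0plus p)
    (hX : Tendsto (fun n : ℕ => (n : ℝ)⁻¹ • ((X n)ᵀ * X n)) atTop (𝓝 C))
    (hXmax : Tendsto (fun n : ℕ => (n : ℝ)⁻¹ * ⨆ i : Fin n, ∑ j, X n i j ^ 2) atTop (𝓝 0))
    -- tuning parameters
    (lam : ℕ → ℝ) (hlam_nonneg : ∀ n, 0 ≤ lam n) (lam0 : ℝ)
    (hlam : Tendsto (fun n : ℕ => √(n : ℝ) * lam n) atTop (𝓝 lam0))
    -- Dantzig selector estimators for the responses `y = X β* + ε`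
    (βhat : ℕ → Ω → Fin p → ℝ) (hβhat_meas : ∀ n, AEMeasurable (βhat n) P)
    (hβhat : ∀ n, 1 ≤ n → ∀ᵐ ω ∂P, Dantzig.IsDantzigSelector (X n)
      (X n *ᵥ βstar + fun i : Fin n => ε i ω) (lam n) (βhat n ω)) :
    -- the limiting problem has exactly one solution, so that `u⁰` is well defined
    (∀ v : Fin p → ℝ, ∃! u : Fin p → ℝ, Dantzig.IsLimitSolution βstar C v lam0 u) ∧
    ∀ {Ω' : Type*} [MeasurableSpace Ω'] (P' : Measure Ω') [IsProbabilityMeasure P']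
      (v0 : Ω' → EuclideanSpace ℝ (Fin p)) (u0 : Ω' → Fin p → ℝ),
      HasLaw v0 (multivariateGaussian 0 (σ ^ 2 • C)) P' →
      (∀ᵐ ω ∂P', Dantzig.IsLimitSolution βstar C (v0 ω).ofLp lam0 (u0 ω)) →
      TendstoInDistribution (fun (n : ℕ) ω => √(n : ℝ) • (βhat n ω - βstar)) atTop u0
        (fun _ => P) P' ∧
      -- the limit is in general not normal
      (1 ≤ p → βstar = 0 → σ ≠ 0 → 0 < lam0 → ¬ IsGaussian (P'.map u0)) := by
  have hlam0 : 0 ≤ lam0 := ge_of_tendsto' hlam fun n => mul_nonneg (Real.sqrt_nonneg _)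
    (hlam_nonneg n)
  have hex := Dantzig.existsUnique_isLimitSolution βstar hC hlam0
  refine ⟨hex, ?_⟩
  intro Ω' _ P' _ v0 u0 hv0 hu0
  choose T hT using fun v => (hex v).exists
  have hTc := Dantzig.continuous_of_isLimitSolution hC hT
  have hscore := (tendstoInDistribution_score hε_meas hε_indep hε_ident (hε_sq 0) (hε_mean 0)
    (hε_var 0) hC.1.1 hX hXmax hv0).continuous_comp (PiLp.continuous_ofLp 2 _)
  have hTscore := hscore.continuous_comp hTc
  -- Uniqueness identifies `u0` with `T v⁰` almost surely, which also supplies its a.e.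
  -- measurability.
  have hu0T : T ∘ WithLp.ofLp ∘ v0 =ᵐ[P'] u0 := by
    filter_upwards [hu0] with ω hω
    exact (hT _).unique hC hω
  have hmeas (n : ℕ) : AEMeasurable (fun ω => √(n : ℝ) • (βhat n ω - βstar)) P :=
    ((hβhat_meas n).sub_const βstar).const_smul √(n : ℝ)
  have hconv : TendstoInDistribution (fun (n : ℕ) ω => √(n : ℝ) • (βhat n ω - βstar)) atTop u0
      (fun _ => P) P' := by
    -- Slutsky: outside the rare event that the score has norm at least `R`, the rescaled error is
    -- within `η` of `T` of the score.
    refine TendstoInDistribution.congr (fun _ => Filter.EventuallyEq.rfl) hu0T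
      (tendstoInDistribution_of_tendstoInMeasure_sub _ _ hTscore ?_ hmeas)
    rw [tendstoInMeasure_iff_norm]
    intro η hη
    rw [ENNReal.tendsto_nhds_zero]
    intro δ hδ
    obtain ⟨R, hR⟩ := hscore.exists_eventually_measure_norm_ge_lt hδ
    have hsqrt : Tendsto (fun n : ℕ => √(n : ℝ)) atTop atTop :=
      Real.tendsto_sqrt_atTop.comp tendsto_natCast_atTop_atTop
    filter_upwards [hR, eventually_ge_atTop 1, Dantzig.eventually_norm_sub_lt_of_isMinOn hC
      (Dantzig.eventually_localObjective_eq hsqrt βstar) hX hlam hT R hη] with n hn h1 hclose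
    refine (measure_mono_ae ?_).trans hn.le
    filter_upwards [hβhat n h1] with ω hω hle
    by_contra hlt
    have hsel := hω.isMinOn_localObjective h1
    have := hclose _ _ (le_of_lt (not_le.1 hlt)) hsel.1 hsel.2
    have hle' : η ≤ ‖√(n : ℝ) • (βhat n ω - βstar) -
      T ((√(n : ℝ))⁻¹ • ((X n)ᵀ *ᵥ fun i : Fin n => ε i ω))‖ := by
      have hmem : ω ∈ {x | η ≤ _} := hle
      simpa using hmem
    exact absurd this (not_lt.2 hle')
  refine ⟨hconv, fun hp hβ hσ hpos => ?_⟩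
  subst hβ
  exact Dantzig.not_isGaussian_map_of_isLimitSolution_zero hp hC (by positivity) hpos hv0
    hconv.aemeasurable_limit hu0
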